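/- Let $p\ge 2$ be an integer, let $\zeta\in\mathbb C$ be a primitive $p$-th root of unity, and let $\mathfrak u,\mathfrak v\in M_p(\mathbb C)$ be the Weyl unitaries: $\mathfrak u=\mathrm{diag}(1,\zeta,\dots,\zeta^{p-1})$, and $\mathfrak v$ is the cyclic shift with $\mathfrak v e_j=e_{j+1}$ for $1\le j<p$ and $\mathfrak v e_p=e_1$. For a $g$-tuple $z=(z_1,\dots,z_g)$ of $d\times d$ complex matrices, put $\mathcal O_z=\mathrm{Span}_{\mathbb C}\{1,z_k,z_k^*: 1\le k\le g\}$, and let the matrix range of $z$ be the sequence $W(z)=(W^n(z))_{n\ge1}$, where $$W^n(z)=\{(\psi(z_1),\dots,\psi(z_g)) : \psi:\mathcal O_z\to M_n(\mathbb C)\text{ is linear, unital and completely positive}\}.$$ A sequence $K=(K_n)_{n\ge 1}$ of sets $K_n\subseteq M_n(\mathbb C)^g$ is matrix convex if $\sum_{j=1}^m\gamma_j^*a_j\gamma_j\in K_n$ whenever $a_j\in K_{n_j}$ and $\gamma_j:\mathbb C^n\to\mathbb C^{n_j}$ are linear maps with $\sum_{j=1}^m\gamma_j^*\gamma_j=1_n$;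 here $\gamma^*a\gamma$ is formed entrywise on the tuple $a$. An element $b\in K_n$ of a matrix convex $K$ is an absolute extreme point of $K$ if, whenever $b=\sum_{j=1}^m\gamma_j^*a_j\gamma_j$ with $a_j\in K_{n_j}$, all $\gamma_j\neq0$ and $\sum_{j=1}^m\gamma_j^*\gamma_j=1_n$, then for each $j$ either (i) $n_j=n$ and $a_j$ is unitarily equivalent to $b$, or (ii) $n_j>n$ and $a_j$ is unitarily equivalent to $b\oplus c_j$ for some $c_j\in K_{n_j-n}$. Then $W(\mathfrak u,\mathfrak v)$ is matrix convex, and the Weyl pair $(\mathfrak u,\mathfrak v)\in W^p(\mathfrak u,\mathfrak v)$ is an absolute extreme point of $W(\mathfrak u,\mathfrak v)$. -/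

import Mathlib

open scoped Matrix ComplexOrder

noncomputable section

/-- The complex `n × n` matrices. -/
abbrev CMat (n : ℕ) : Type := Matrix (Fin n) (Fin n) ℂ

/-- The diagonal Weyl unitary `diag(1, ζ, …, ζ^(p-1))`. -/
def weylU (p : ℕ) (ζ : ℂ) : CMat p :=
  Matrix.diagonal fun i => ζ ^ (i : ℕ)

/-- The cyclic shift Weyl unitary: ones on the subdiagonal and in the upper right corner. -/
def weylV (p : ℕ) : CMat p :=
  Matrix.of fun i j => if (i : ℕ) = ((j : ℕ) + 1) % p then 1 else 0

/-- The Weyl pair. -/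
def weylPair (p : ℕ) (ζ : ℂ) : Fin 2 → CMat p :=
  ![weylU p ζ, weylV p]

/-- The operator system of a tuple `z` of matrices: the span of `1`, the `z k` and the `(z k)ᴴ`. -/
def operatorSystem {g d : ℕ} (z : Fin g → CMat d) : Submodule ℂ (CMat d) :=
  Submodule.span ℂ ({1} ∪ Set.range z ∪ Set.range fun k => (z k)ᴴ)

theorem one_mem_operatorSystem {g d : ℕ} (z : Fin g → CMat d) :
    (1 : CMat d) ∈ operatorSystem z :=
  Submodule.subset_span (Or.inl (Or.inl rfl))

theorem mem_operatorSystem {g d : ℕ} (z : Fin g → CMat d) (k : Fin g) :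
    z k ∈ operatorSystem z :=
  Submodule.subset_span (Or.inl (Or.inr ⟨k, rfl⟩))

/-- Complete positivity of a linear map `ψ : S → M_n(ℂ)` on a subspace `S` of `M_d(ℂ)`: for every
`k`, if a `k × k` matrix over `S` is positive semidefinite as a matrix of size `kd`, then its
entrywise image is positive semidefinite as a matrix of size `kn`. -/
def IsCompletelyPositive {d n : ℕ} {S : Submodule ℂ (CMat d)} (ψ : S →ₗ[ℂ] CMat n) : Prop :=
  ∀ (k : ℕ) (x : Matrix (Fin k) (Fin k) S),
    (Matrix.comp (Fin k) (Fin k) (Fin d) (Fin d) ℂ (x.map fun s => (s : CMat d))).PosSemidef →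
    (Matrix.comp (Fin k) (Fin k) (Fin n) (Fin n) ℂ (x.map ψ)).PosSemidef

/-- The matrix range of `z`: at level `n`, all tuples `(ψ (z 1), …, ψ (z g))` where
`ψ` is a unital completely positive map from the operator system of `z` to `M_n(ℂ)`. -/
def matrixRange {g d : ℕ} (z : Fin g → CMat d) (n : ℕ) : Set (Fin g → CMat n) :=
  {a | ∃ ψ : operatorSystem z →ₗ[ℂ] CMat n,
    ψ ⟨1, one_mem_operatorSystem z⟩ = 1 ∧ IsCompletelyPositive ψ ∧
    ∀ k, a k = ψ ⟨z k, mem_operatorSystem z k⟩}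

/-- `b = ∑ j, (γ j)ᴴ (a j) (γ j)` with `∑ j, (γ j)ᴴ (γ j) = 1`, where `γ j : ℂ^n → ℂ^(d j)`. -/
def IsMatrixConvexCombination {g n m : ℕ} (b : Fin g → CMat n) (d : Fin m → ℕ)
    (a : (j : Fin m) → Fin g → CMat (d j))
    (γ : (j : Fin m) → Matrix (Fin (d j)) (Fin n) ℂ) : Prop :=
  ∑ j, (γ j)ᴴ * γ j = 1 ∧ ∀ k, b k = ∑ j, (γ j)ᴴ * a j k * γ j

/-- Matrix convexity of a sequence of sets `K n ⊆ M_n(ℂ)^g`; only levels `n ≥ 1` matter. -/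
def IsMatrixConvex {g : ℕ} (K : (n : ℕ) → Set (Fin g → CMat n)) : Prop :=
  ∀ (n m : ℕ) (b : Fin g → CMat n) (d : Fin m → ℕ) (a : (j : Fin m) → Fin g → CMat (d j))
    (γ : (j : Fin m) → Matrix (Fin (d j)) (Fin n) ℂ),
    0 < n → (∀ j, 0 < d j) → (∀ j, a j ∈ K (d j)) → IsMatrixConvexCombination b d a γ → b ∈ K n

/-- Unitary equivalence `b = γᴴ a γ`. The index types may differ (a unitary `γ` forces them
to have the same size), so that tuples can be compared with direct sums. -/
def UnitarilyEquivalent {g : ℕ} {ι κ : Type} [Fintype ι] [DecidableEq ι] [Fintype κ]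
    [DecidableEq κ] (a : Fin g → Matrix ι ι ℂ) (b : Fin g → Matrix κ κ ℂ) : Prop :=
  ∃ γ : Matrix ι κ ℂ, γᴴ * γ = 1 ∧ γ * γᴴ = 1 ∧ ∀ k, b k = γᴴ * a k * γ

/-- The direct sum `b ⊕ c` of two tuples, as block diagonal matrices. -/
def tupleDirectSum {g n l : ℕ} (b : Fin g → CMat n) (c : Fin g → CMat l) :
    Fin g → Matrix (Fin n ⊕ Fin l) (Fin n ⊕ Fin l) ℂ :=
  fun k => Matrix.fromBlocks (b k) 0 0 (c k)

/-- `b ∈ K n` is an absolute extreme point of the matrix convex set `K`: whenever `b` is a matrix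
convex combination of `a j ∈ K (d j)` with all coefficients nonzero, each `a j` is unitarily
equivalent to `b`, or has larger size and is unitarily equivalent to `b ⊕ c` for some `c ∈ K`. -/
structure IsAbsoluteExtremePoint {g : ℕ} (K : (n : ℕ) → Set (Fin g → CMat n)) {n : ℕ}
    (b : Fin g → CMat n) : Prop where
  matrixConvex : IsMatrixConvex K
  mem : b ∈ K n
  extreme : ∀ (m : ℕ) (d : Fin m → ℕ) (a : (j : Fin m) → Fin g → CMat (d j))
    (γ : (j : Fin m) → Matrix (Fin (d j)) (Fin n) ℂ),
    (∀ j, a j ∈ K (d j)) → (∀ j, γ j ≠ 0) → IsMatrixConvexCombination b d a γ →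
    ∀ j, (d j = n ∧ UnitarilyEquivalent (a j) b) ∨
      ∃ l : ℕ, 0 < l ∧ d j = n + l ∧
        ∃ c ∈ K l, UnitarilyEquivalent (a j) (tupleDirectSum b c)

end

open scoped Matrix ComplexOrder

section CompletelyPositive

variable {g d n : ℕ}

/-! Both Weyl matrices are unitary, whereas the matrix range contains only tuples of contractions.
In a matrix convex combination equal to the Weyl pair `b`, the contraction bounds are therefore
tight, and `intertwine_of_contraction` gives `a j * γ j = γ j * b` in each coordinate, likewise for
adjoints. So `(γ j)ᴴ * γ j` commutes with `b`; by irreducibility it is a scalar, nonzero since `γ j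
≠ 0`. A rescaled `γ j` is then an isometry whose range reduces `a j`, which splits off `b`; the
complement is a compression of `a j`, hence in the matrix range by matrix convexity. -/

/-- The ampliation `1 ⊗ γ`, as a matrix on pairs of indices. -/
def ampliation {n d : ℕ} (k : ℕ) (γ : Matrix (Fin d) (Fin n) ℂ) :
    Matrix (Fin k × Fin d) (Fin k × Fin n) ℂ :=
  Matrix.blockDiagonal (fun _ : Fin k => γ) |>.submatrix Prod.swap Prod.swap

/-- Reduces positivity of an amplified compression to congruence invariance of positive
semidefiniteness. -/
theorem comp_map_conj {S : Type*} (k : ℕ) (γ : Matrix (Fin d) (Fin n) ℂ)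
    (x : Matrix (Fin k) (Fin k) S) (f : S → CMat d) :
    Matrix.comp (Fin k) (Fin k) (Fin n) (Fin n) ℂ (x.map fun s => γᴴ * f s * γ) =
      (ampliation k γ)ᴴ * Matrix.comp (Fin k) (Fin k) (Fin d) (Fin d) ℂ (x.map f) *
        ampliation k γ := by
  ext ⟨i, s⟩ ⟨j, t⟩
  simp [ampliation, Matrix.mul_apply, Matrix.blockDiagonal_apply, Fintype.sum_prod_type,
    Finset.sum_mul, Finset.sum_ite_eq, apply_ite]

theorem isCompletelyPositive_sum_conj {m : ℕ} {D : ℕ} {S : Submodule ℂ (CMat D)} (d : Fin m → ℕ)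
    (γ : (j : Fin m) → Matrix (Fin (d j)) (Fin n) ℂ) (ψ : (j : Fin m) → S →ₗ[ℂ] CMat (d j))
    (hψ : ∀ j, IsCompletelyPositive (ψ j)) (φ : S →ₗ[ℂ] CMat n)
    (hφ : ∀ s, φ s = ∑ j, (γ j)ᴴ * ψ j s * γ j) : IsCompletelyPositive φ := by
  intro k x hx
  have h : Matrix.comp (Fin k) (Fin k) (Fin n) (Fin n) ℂ (x.map φ) =
      ∑ j, (ampliation k (γ j))ᴴ *
        Matrix.comp (Fin k) (Fin k) (Fin (d j)) (Fin (d j)) ℂ (x.map (ψ j)) *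
          ampliation k (γ j) := by
    simp_rw [← comp_map_conj]
    ext ⟨i, s⟩ ⟨j, t⟩
    simp [Matrix.sum_apply, hφ]
  rw [h]
  exact Matrix.posSemidef_sum _ fun j _ => (hψ j k x hx).conjTranspose_mul_mul_same _

theorem isMatrixConvex_matrixRange (z : Fin g → CMat d) : IsMatrixConvex (matrixRange z) := by
  intro n m b d a γ _ _ ha hb
  choose ψ h1 hψ haψ using ha
  let φ : operatorSystem z →ₗ[ℂ] CMat n :=
    { toFun := fun s => ∑ j, (γ j)ᴴ * ψ j s * γ j
      map_add' := fun s t => by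
        simp [Matrix.mul_add, Matrix.add_mul, Finset.sum_add_distrib]
      map_smul' := fun c s => by
        simp [Finset.smul_sum] }
  refine ⟨φ, ?_, isCompletelyPositive_sum_conj d γ ψ hψ φ fun _ => rfl, fun k => ?_⟩
  · change ∑ j, (γ j)ᴴ * ψ j _ * γ j = 1
    simp only [h1, Matrix.mul_one, hb.1]
  · change b k = ∑ j, (γ j)ᴴ * ψ j _ * γ j
    simp only [hb.2 k, haψ]

theorem self_mem_matrixRange (z : Fin g → CMat d) : z ∈ matrixRange z d :=
  ⟨(operatorSystem z).subtype, rfl, fun _ _ hx => hx, fun _ => rfl⟩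

/-- The row with blocks `a` and `b`, as a matrix whose columns are indexed by pairs. -/
def blockRow {ι κ : Type*} (a b : Matrix ι κ ℂ) : Matrix ι (Fin 2 × κ) ℂ :=
  Matrix.of fun i q => ![a, b] q.1 i q.2

/-- The matrix range of a tuple of isometries consists of tuples of contractions, and so does
the set of their adjoints. -/
theorem contraction_of_mem_matrixRange {z : Fin g → CMat d} {a : Fin g → CMat n} {k : Fin g}
    (hz : (z k)ᴴ * z k = 1) (ha : a ∈ matrixRange z n) :
    (1 - (a k)ᴴ * a k).PosSemidef ∧ (1 - a k * (a k)ᴴ).PosSemidef := by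
  obtain ⟨ψ, h1, hψ, haψ⟩ := ha
  let e : operatorSystem z := ⟨1, one_mem_operatorSystem z⟩
  let s : operatorSystem z := ⟨z k, mem_operatorSystem z k⟩
  let t : operatorSystem z := ⟨(z k)ᴴ, Submodule.subset_span (Or.inr ⟨k, rfl⟩)⟩
  -- This is `Rᴴ * R` for the row `R = (1, z k)`; the lower right block is `1` because `z k` is an
  -- isometry.
  have hx : (Matrix.comp (Fin 2) (Fin 2) (Fin d) (Fin d) ℂ
      ((!![e, s; t, e]).map fun s => (s : CMat d))).PosSemidef := by
    have : Matrix.comp (Fin 2) (Fin 2) (Fin d) (Fin d) ℂ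
        ((!![e, s; t, e]).map fun s => (s : CMat d)) =
        (blockRow 1 (z k))ᴴ * blockRow 1 (z k) := by
      ext ⟨i, q⟩ ⟨j, r⟩
      change _ = ((![1, z k] i)ᴴ * ![1, z k] j) q r
      fin_cases i <;> fin_cases j <;> simp [e, s, t, hz]
    rw [this]
    exact Matrix.posSemidef_conjTranspose_mul_self _
  have hy := hψ 2 _ hx
  have hes : ψ e = 1 := h1
  have hs : ψ s = a k := (haψ k).symm
  -- Adjoints are preserved because a positive semidefinite image is Hermitian.
  have ht : ψ t = (a k)ᴴ := by
    ext q r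
    have := congrFun (congrFun hy.1 (1, q)) (0, r)
    simpa [hs] using this.symm
  have hM : Matrix.comp (Fin 2) (Fin 2) (Fin n) (Fin n) ℂ ((!![e, s; t, e]).map ψ) =
      Matrix.comp (Fin 2) (Fin 2) (Fin n) (Fin n) ℂ !![1, a k; (a k)ᴴ, 1] := by
    congr 1
    ext i j : 2
    fin_cases i <;> fin_cases j <;> simp [hes, hs, ht]
  rw [hM] at hy
  have key (r₀ r₁ : CMat n) : blockRow r₀ r₁ *
      Matrix.comp (Fin 2) (Fin 2) (Fin n) (Fin n) ℂ !![1, a k; (a k)ᴴ, 1] *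
        (blockRow r₀ r₁)ᴴ =
      r₀ * r₀ᴴ + r₁ * (a k)ᴴ * r₀ᴴ + (r₀ * a k * r₁ᴴ + r₁ * r₁ᴴ) := by
    ext i j
    simp [blockRow, Matrix.mul_apply, Fintype.sum_prod_type, Matrix.one_apply, add_mul,
      Finset.sum_add_distrib]
    abel
  constructor
  -- A Schur complement: the row is chosen so that the congruence collapses to `1 - (a k)ᴴ * a k`.
  · have h := hy.mul_mul_conjTranspose_same (blockRow (-(a k)ᴴ) 1)
    rw [key] at h
    convert h using 1
    simp
    abel
  · have h := hy.mul_mul_conjTranspose_same (blockRow 1 (-a k))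
    rw [key] at h
    convert h using 1
    simp
    abel

end CompletelyPositive

section Rigidity

variable {n : ℕ}

/-- If an isometry is a matrix convex combination of contractions, then every coefficient
intertwines it with the corresponding contraction. -/
theorem intertwine_of_contraction {m : ℕ} {d : Fin m → ℕ} {a : (j : Fin m) → CMat (d j)}
    {γ : (j : Fin m) → Matrix (Fin (d j)) (Fin n) ℂ} {b : CMat n}
    (hγ : ∑ j, (γ j)ᴴ * γ j = 1) (hb : b = ∑ j, (γ j)ᴴ * a j * γ j) (hbb : bᴴ * b = 1)
    (ha : ∀ j, (1 - (a j)ᴴ * a j).PosSemidef) (j : Fin m) : a j * γ j = γ j * b := by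
  have hb' : bᴴ = ∑ j, (γ j)ᴴ * (a j)ᴴ * γ j := by
    rw [hb, Matrix.conjTranspose_sum]
    simp [Matrix.mul_assoc]
  -- Defects of intertwining and of isometry together sum to `1 - bᴴ * b = 0`; both are positive, so
  -- taking traces kills each one.
  have hsum : ∑ j, ((a j * γ j - γ j * b)ᴴ * (a j * γ j - γ j * b) +
      (γ j)ᴴ * (1 - (a j)ᴴ * a j) * γ j) = 0 := by
    have hj (j : Fin m) : (a j * γ j - γ j * b)ᴴ * (a j * γ j - γ j * b) +
        (γ j)ᴴ * (1 - (a j)ᴴ * a j) * γ j =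
        (γ j)ᴴ * γ j + bᴴ * ((γ j)ᴴ * γ j) * b - (γ j)ᴴ * (a j)ᴴ * γ j * b -
          bᴴ * ((γ j)ᴴ * a j * γ j) := by
      simp only [Matrix.conjTranspose_sub, Matrix.conjTranspose_mul, Matrix.sub_mul,
        Matrix.mul_sub, Matrix.mul_assoc, Matrix.mul_one]
      abel
    simp only [hj, Finset.sum_sub_distrib, Finset.sum_add_distrib, ← Finset.sum_mul,
      ← Finset.mul_sum, hγ, ← hb, ← hb', hbb, Matrix.mul_one]
    abel
  have hpos (j : Fin m) : ((a j * γ j - γ j * b)ᴴ * (a j * γ j - γ j * b)).PosSemidef :=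
    Matrix.posSemidef_conjTranspose_mul_self _
  have hpos' (j : Fin m) : ((γ j)ᴴ * (1 - (a j)ᴴ * a j) * γ j).PosSemidef :=
    (ha j).conjTranspose_mul_mul_same _
  have htr := congrArg Matrix.trace hsum
  rw [Matrix.trace_sum, Matrix.trace_zero, Finset.sum_eq_zero_iff_of_nonneg
    fun j _ => ((hpos j).add (hpos' j)).trace_nonneg] at htr
  have h := htr j (Finset.mem_univ j)
  rw [Matrix.trace_add] at h
  have h0 := ((add_eq_zero_iff_of_nonneg (hpos j).trace_nonneg (hpos' j).trace_nonneg).1 h).1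
  exact sub_eq_zero.1 (Matrix.trace_conjTranspose_mul_self_eq_zero_iff.1 h0)

/-- An isometry `ℂ^n → ℂ^d` is the first block column of a unitary. -/
theorem exists_unitary_extension {d : ℕ} (w : Matrix (Fin d) (Fin n) ℂ) (hw : wᴴ * w = 1) :
    ∃ l : ℕ, d = n + l ∧ ∃ w' : Matrix (Fin d) (Fin l) ℂ,
      (Matrix.fromCols w w')ᴴ * Matrix.fromCols w w' = 1 ∧
        Matrix.fromCols w w' * (Matrix.fromCols w w')ᴴ = 1 := by
  let v : Fin n → EuclideanSpace ℂ (Fin d) := fun i => WithLp.toLp 2 (w.col i)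
  have hinner (x y : EuclideanSpace ℂ (Fin d)) : inner ℂ x y = ∑ i, star (x i) * y i := by
    simp [PiLp.inner_apply, mul_comm]
  have hv : Orthonormal ℂ v := by
    rw [orthonormal_iff_ite]
    intro i j
    have := congrFun (congrFun hw i) j
    simpa [hinner, v, Matrix.mul_apply, Matrix.one_apply] using this
  have hnd : n ≤ d := by
    simpa using hv.linearIndependent.fintype_card_le_finrank
  obtain ⟨l, rfl⟩ := Nat.exists_eq_add_of_le hnd
  refine ⟨l, rfl, ?_⟩
  -- The zeros are placeholders: the basis extension only uses `V` on the left summand.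
  let V : Fin n ⊕ Fin l → EuclideanSpace ℂ (Fin (n + l)) := Sum.elim v fun _ => 0
  have hV : Orthonormal ℂ ((Set.range (Sum.inl : Fin n → Fin n ⊕ Fin l)).domRestrict V) := by
    rw [orthonormal_iff_ite] at hv ⊢
    rintro ⟨_, i, rfl⟩ ⟨_, j, rfl⟩
    simpa [V, Set.domRestrict, Subtype.ext_iff] using hv i j
  obtain ⟨B, hB⟩ := hV.exists_orthonormalBasis_extension_of_card_eq (by simp)
  have hBw (i : Fin n) : B (Sum.inl i) = v i := hB _ ⟨i, rfl⟩
  let w' : Matrix (Fin (n + l)) (Fin l) ℂ := Matrix.of fun i j => B (Sum.inr j) i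
  have hQ (i : Fin (n + l)) (q : Fin n ⊕ Fin l) : Matrix.fromCols w w' i q = B q i := by
    rcases q with q | q
    · simp [hBw, v]
    · simp [w']
  have h1 : (Matrix.fromCols w w')ᴴ * Matrix.fromCols w w' = 1 := by
    ext q r
    have := orthonormal_iff_ite.1 B.orthonormal q r
    rw [hinner] at this
    simpa only [Matrix.mul_apply, Matrix.conjTranspose_apply, hQ, Matrix.one_apply] using this
  exact ⟨w', h1, (Matrix.mul_eq_one_comm_of_card_eq _ _ _ (by simp)).1 h1⟩

end Rigidity

section Weyl

theorem weylU_conjTranspose_mul_self {p : ℕ} (hp : p ≠ 0) {ζ : ℂ} (hζ : IsPrimitiveRoot ζ p) :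
    (weylU p ζ)ᴴ * weylU p ζ = 1 := by
  have h : star ζ * ζ = 1 := by
    have := hζ.norm'_eq_one hp
    simp [← Complex.normSq_eq_conj_mul_self, Complex.normSq_eq_norm_sq, this]
  rw [weylU, Matrix.diagonal_conjTranspose, Matrix.diagonal_mul_diagonal, ← Matrix.diagonal_one]
  congr 1
  ext i
  simp only [Pi.star_apply, star_pow, ← mul_pow, h, one_pow]

theorem weylV_apply {p : ℕ} [NeZero p] (i j : Fin p) :
    weylV p i j = if i = j + 1 then 1 else 0 := by
  simp [weylV, Fin.ext_iff, Fin.val_add]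

theorem weylV_conjTranspose_mul_self {p : ℕ} [NeZero p] : (weylV p)ᴴ * weylV p = 1 := by
  ext i j
  simp [Matrix.mul_apply, weylV_apply, Matrix.one_apply, eq_comm]

theorem weylPair_conjTranspose_mul_self {p : ℕ} [NeZero p] {ζ : ℂ} (hζ : IsPrimitiveRoot ζ p)
    (k : Fin 2) : (weylPair p ζ k)ᴴ * weylPair p ζ k = 1 := by
  fin_cases k
  · exact weylU_conjTranspose_mul_self (NeZero.ne p) hζ
  · exact weylV_conjTranspose_mul_self

/-- The Weyl pair is irreducible: its commutant consists of the scalar matrices. -/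
theorem eq_smul_one_of_commute_weylPair {p : ℕ} [NeZero p] {ζ : ℂ} (hζ : IsPrimitiveRoot ζ p)
    {x : CMat p} (hx : ∀ k, x * weylPair p ζ k = weylPair p ζ k * x) : x = x 0 0 • 1 := by
  -- The diagonal entries of `weylU` are distinct.
  have hoff (i j : Fin p) (hij : i ≠ j) : x i j = 0 := by
    have h := congrFun (congrFun (hx 0) i) j
    simp only [weylPair, weylU, Matrix.cons_val_zero, Matrix.mul_diagonal,
      Matrix.diagonal_mul] at h
    by_contra h0
    rw [mul_comm] at h
    exact hij (Fin.ext (hζ.pow_inj i.2 j.2 (mul_right_cancel₀ h0 h).symm))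
  -- The shift makes the diagonal of `x` constant.
  have hstep (i : Fin p) : x (i + 1) (i + 1) = x i i := by
    have h := congrFun (congrFun (hx 1) (i + 1)) i
    simpa [weylPair, Matrix.mul_apply, weylV_apply] using h
  have hdiag (m : ℕ) (hm : m < p) : x ⟨m, hm⟩ ⟨m, hm⟩ = x 0 0 := by
    induction m with
    | zero => rfl
    | succ m ih =>
      rw [← ih (by omega), ← hstep ⟨m, by omega⟩]
      have : (⟨m, by omega⟩ : Fin p) + 1 = ⟨m + 1, hm⟩ := by
        ext
        simp [Fin.val_add, Nat.mod_eq_of_lt hm]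
      rw [this]
  ext i j
  by_cases hij : i = j
  · subst hij
    simp [hdiag i.1 i.2]
  · simp [hoff i j hij, hij]

end Weyl

/-- If an isometry `w` intertwines the tuples `a` and `b` and their adjoints, then `b` is a direct
summand of `a`, whose complement is a compression of `a`. -/
theorem direct_summand_of_intertwine {g n d : ℕ} {K : (n : ℕ) → Set (Fin g → CMat n)}
    (hK : IsMatrixConvex K) {a : Fin g → CMat d} {b : Fin g → CMat n} (ha : a ∈ K d)
    {w : Matrix (Fin d) (Fin n) ℂ} (hw : wᴴ * w = 1) (h : ∀ k, a k * w = w * b k)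
    (h' : ∀ k, (a k)ᴴ * w = w * (b k)ᴴ) :
    (d = n ∧ UnitarilyEquivalent a b) ∨ ∃ l : ℕ, 0 < l ∧ d = n + l ∧
      ∃ c ∈ K l, UnitarilyEquivalent a (tupleDirectSum b c) := by
  obtain ⟨l, hl, w', h1, h2⟩ := exists_unitary_extension w hw
  rcases Nat.eq_zero_or_pos l with rfl | hl0
  · obtain rfl : d = n := hl
    refine Or.inl ⟨rfl, w, hw, mul_eq_one_comm.1 hw, fun k => ?_⟩
    rw [Matrix.mul_assoc, h, ← Matrix.mul_assoc, hw, Matrix.one_mul]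
  · right
    have hb1 := h1
    rw [Matrix.conjTranspose_fromCols_eq_fromRows_conjTranspose, Matrix.fromRows_mul_fromCols,
      ← Matrix.fromBlocks_one, Matrix.fromBlocks_inj] at hb1
    obtain ⟨-, h12, h21, h22⟩ := hb1
    refine ⟨l, hl0, hl, fun k => w'ᴴ * a k * w', ?_, Matrix.fromCols w w', h1, h2, fun k => ?_⟩
    · refine hK l 1 _ (fun _ => d) (fun _ => a) (fun _ => w') hl0 (fun _ => by omega)
        (fun _ => ha) ⟨by simpa using h22, fun k => by simp⟩
    -- The adjoint relation kills the upper right block, the relation `h` the lower left one.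
    · have hwa : wᴴ * a k = b k * wᴴ := by
        simpa using congrArg Matrix.conjTranspose (h' k)
      rw [Matrix.conjTranspose_fromCols_eq_fromRows_conjTranspose, Matrix.fromRows_mul,
        Matrix.fromRows_mul_fromCols, hwa, Matrix.mul_assoc, hw, Matrix.mul_assoc, h12,
        Matrix.mul_assoc, h, ← Matrix.mul_assoc, h21]
      simp [tupleDirectSum]

theorem mainTheorem5 (p : ℕ) (hp : 2 ≤ p) (ζ : ℂ) (hζ : IsPrimitiveRoot ζ p) :
    IsAbsoluteExtremePoint (matrixRange (weylPair p ζ)) (weylPair p ζ) := by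
  have : NeZero p := ⟨by omega⟩
  have hK := isMatrixConvex_matrixRange (weylPair p ζ)
  refine ⟨hK, self_mem_matrixRange _, fun m d a γ ha hγ hcomb j => ?_⟩
  have hz := weylPair_conjTranspose_mul_self hζ
  have h (k : Fin 2) : a j k * γ j = γ j * weylPair p ζ k :=
    intertwine_of_contraction (a := fun j => a j k) hcomb.1 (hcomb.2 k) (hz k)
      (fun j => (contraction_of_mem_matrixRange (hz k) (ha j)).1) j
  have h' (k : Fin 2) : (a j k)ᴴ * γ j = γ j * (weylPair p ζ k)ᴴ := by
    refine intertwine_of_contraction (a := fun j => (a j k)ᴴ) hcomb.1 ?_ ?_ (fun j => ?_) j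
    · rw [hcomb.2 k, Matrix.conjTranspose_sum]
      simp [Matrix.mul_assoc]
    · simpa using mul_eq_one_comm.1 (hz k)
    · simpa using (contraction_of_mem_matrixRange (hz k) (ha j)).2
  have hscalar := eq_smul_one_of_commute_weylPair hζ (x := (γ j)ᴴ * γ j) fun k => by
    have hk : (γ j)ᴴ * a j k = weylPair p ζ k * (γ j)ᴴ := by
      simpa using congrArg Matrix.conjTranspose (h' k)
    rw [Matrix.mul_assoc, ← h, ← Matrix.mul_assoc, hk, Matrix.mul_assoc]
  have hnonneg : 0 ≤ ((γ j)ᴴ * γ j) 0 0 :=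
    (Matrix.posSemidef_conjTranspose_mul_self (γ j)).diag_nonneg
  obtain ⟨r, hr, hr'⟩ : ∃ r : ℝ, 0 ≤ r ∧ ((γ j)ᴴ * γ j) 0 0 = r :=
    ⟨_, (Complex.nonneg_iff.1 hnonneg).1, Complex.eq_re_of_ofReal_le hnonneg⟩
  rw [hr'] at hscalar
  have hr0 : r ≠ 0 := by
    rintro rfl
    exact hγ j (Matrix.conjTranspose_mul_self_eq_zero.1 (by simpa using hscalar))
  have hs : ((√r)⁻¹ : ℝ) * ((√r)⁻¹ : ℝ) * r = 1 := by
    rw [← mul_inv, Real.mul_self_sqrt hr, inv_mul_cancel₀ hr0]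
  refine direct_summand_of_intertwine hK (ha j) (w := (((√r)⁻¹ : ℝ) : ℂ) • γ j) ?_
    (fun k => by simp [h]) (fun k => by simp [h'])
  rw [Matrix.conjTranspose_smul, Matrix.smul_mul, Matrix.mul_smul, hscalar, smul_smul, smul_smul]
  have : (star (((√r)⁻¹ : ℝ) : ℂ) * (((√r)⁻¹ : ℝ) : ℂ) * (r : ℂ)) = 1 := by
    rw [Complex.star_def, Complex.conj_ofReal]
    exact_mod_cast hs
  rw [this, one_smul]
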